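/- Let $\mathcal G$ be a connected weighted undirected graph on $\{1,\dots,N\}$ with weights $a_{ij}=a_{ji}\ge 0$, $a_{ii}=0$, where $i,j$ are adjacent iff $a_{ij}>0$; for $v\in\mathbb R^N$ write $v_i^v=\sum_{j=1}^N a_{ij}(v_i-v_j)$. Consider $N$ agents $\dot x_i=g_i(x_i,u_i)$, $y_i=h_i(x_i)$, with $x_i\in\mathbb R^{n_i}$, $u_i,y_i\in\mathbb R$ and $g_i,h_i$ smooth. Let $d_i^0\in\mathbb R$ be given and let $y^*=(y_1^*,\dots,y_N^*)$ be the optimal solution of the problem of minimizing $\sum_{i}\frac12 y_i^2$ subject to $\sum_i y_i=\sum_i d_i^0$. Agent $i$ observes $d_i(t)=d_i^0+\sum_{j=1}^{k_i}A_{ij}\sin(\omega_{ij}t+\varphi_{ij})$ with known distinct frequencies $\omega_{ij}>0$ and unknown amplitudes $A_{ij}$ and phases $\varphi_{ij}$. Assume that for every $i$: (1) there is a unique pair of smooth functions $\mathbf x_i:\mathbb R\to\mathbb R^{n_i}$, $\mathbf u_i:\mathbb R\to\mathbb R$ with $g_i(\mathbf x_i(r),\mathbf u_i(r))=0$ and $h_i(\mathbf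 x_i(r))=r$ for all $r\in\mathbb R$, and $\mathbf u_i$ is $M_i$-Lipschitz on a set $C_i\subseteq\mathbb R$ with $y_i^*\in C_i$ (the concerned set; for example $C_i=\mathbb R$); (2) agent $i$ is passive with respect to $x_i^*=\mathbf x_i(y_i^*)$, $u_i^*=\mathbf u_i(y_i^*)$: there are a continuously differentiable function $V_i:\mathbb R^{n_i}\to\mathbb R$ and class $\mathcal K_\infty$ functions $\alpha_{i1},\alpha_{i2}$ with $\alpha_{i1}(\|x-x_i^*\|)\le V_i(x)\le\alpha_{i2}(\|x-x_i^*\|)$ and $\nabla V_i(x)^\top g_i(x,u)\le (h_i(x)-y_i^*)(u-u_i^*)$ for all $x\in\mathbb R^{n_i}$, $u\in\mathbb R$. Let $S_i=\mathrm{diag}\left(0,\begin{bmatrix}0&\omega_{i1}\\-\omega_{i1}&0\end{bmatrix},\dots,\begin{bmatrix}0&\omega_{ik_i}\\-\omega_{ik_i}&0\end{bmatrix}\right)$, $D_i=[1,1,0,\dots,1,0]$ and $D_i^\epsilon=[0,1,0,\dots,1,0]$ in $\mathbb R^{1\times(2k_i+1)}$, let $L_i\in\mathbb R^{2k_i+1}$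 be such that $S_i-L_iD_i$ is Hurwitz (all its eigenvalues have negative real part), and let $\gamma>1+\max_i M_i$. Consider the closed loop of the agents with the controller $$u_i=-\gamma y_i+\lambda_i+\mathbf u_i(y_i),\qquad \dot\lambda_i=-\lambda_i^v-z_i^v+d_i-y_i-D_i^\epsilon\eta_i,$$ $$\dot\eta_i=(S_i-L_iD_i)\eta_i+L_id_i,\qquad \dot z_i=\lambda_i^v,\qquad i=1,\dots,N.$$ Then for every initial state $(x,\lambda,\eta,z)(0)$ such that along the closed-loop solutions from it, as long as they exist, the outputs satisfy $y_i\in C_i$ for all $i$ (no restriction if $C_i=\mathbb R$), the closed loop has a solution on $[0,\infty)$, and along every such solution all $x_i$ are bounded and $$\lim_{t\to+\infty}y_i(t)=\frac1N\sum_{j=1}^N d_j^0,\qquad i=1,\dots,N.$$ In particular, if $d_j^0=y_j(0)$ for all $j$, then $y_i(t)\to\frac1N\sum_{j=1}^N y_j(0)$ for all $i$, so output average consensus is achieved despite the sinusoidal observation disturbances. -/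

import Mathlib

open Set Filter Topology
open scoped NNReal ContDiff Matrix

/-- A weighted undirected graph on the nodes `Fin N`, given by its adjacency weights. -/
structure WeightedGraph (N : ℕ) where
  weight : Fin N → Fin N → ℝ
  weight_self : ∀ i, weight i i = 0
  weight_symm : ∀ i j, weight i j = weight j i
  weight_nonneg : ∀ i j, 0 ≤ weight i j

/-- The underlying simple graph: `i` and `j` are joined iff the weight is positive. -/
def WeightedGraph.toSimpleGraph {N : ℕ} (G : WeightedGraph N) : SimpleGraph (Fin N) where
  Adj i j := 0 < G.weight i j
  symm := ⟨fun i j h => by rw [G.weight_symm j i]; exact h⟩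
  loopless := ⟨fun i h => by rw [G.weight_self i] at h; exact lt_irrefl 0 h⟩

/-- The local disagreement `∑ j, a i j * (v i - v j)`. -/
def WeightedGraph.disagreement {N : ℕ} (G : WeightedGraph N) (v : Fin N → ℝ) (i : Fin N) : ℝ :=
  ∑ j, G.weight i j * (v i - v j)

/-- A smooth single-input single-output agent `x' = g (x, u)`, `y = h x` with state in `ℝⁿ`. -/
structure Agent (n : ℕ) where
  g : EuclideanSpace ℝ (Fin n) → ℝ → EuclideanSpace ℝ (Fin n)
  h : EuclideanSpace ℝ (Fin n) → ℝ
  g_smooth : ContDiff ℝ ∞ (Function.uncurry g)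
  h_smooth : ContDiff ℝ ∞ h

/-- Smooth functions `X`, `U` that solve the regulator equations for every constant output `r`. -/
structure Agent.SolvesRegulator {n : ℕ} (P : Agent n)
    (X : ℝ → EuclideanSpace ℝ (Fin n)) (U : ℝ → ℝ) : Prop where
  smooth_state : ContDiff ℝ ∞ X
  smooth_input : ContDiff ℝ ∞ U
  equilibrium : ∀ r, P.g (X r) (U r) = 0
  output : ∀ r, P.h (X r) = r

/-- `(X, U)` is the unique pair of smooth functions that solves the regulator equations. -/
def Agent.IsRegulator {n : ℕ} (P : Agent n)
    (X : ℝ → EuclideanSpace ℝ (Fin n)) (U : ℝ → ℝ) : Prop :=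
  P.SolvesRegulator X U ∧ ∀ X' U', P.SolvesRegulator X' U' → X' = X ∧ U' = U

/-- Class `𝒦∞` comparison functions on `[0, ∞)`. -/
structure IsClassKInfty (α : ℝ → ℝ) : Prop where
  continuousOn : ContinuousOn α (Ici 0)
  strictMonoOn : StrictMonoOn α (Ici 0)
  map_zero : α 0 = 0
  tendsto_atTop : Tendsto α atTop atTop

/-- Passivity with respect to the equilibrium `(xs, us)`, with storage function `V`; the output
at the equilibrium is `P.h xs`. -/
def Agent.PassiveAt {n : ℕ} (P : Agent n) (xs : EuclideanSpace ℝ (Fin n)) (us : ℝ) : Prop :=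
  ∃ (V : EuclideanSpace ℝ (Fin n) → ℝ) (α₁ α₂ : ℝ → ℝ),
    ContDiff ℝ 1 V ∧ IsClassKInfty α₁ ∧ IsClassKInfty α₂ ∧
    (∀ x, α₁ ‖x - xs‖ ≤ V x ∧ V x ≤ α₂ ‖x - xs‖) ∧
    ∀ x u, fderiv ℝ V x (P.g x u) ≤ (P.h x - P.h xs) * (u - us)

/-- `y` minimizes `∑ i, f i (y i)` subject to `∑ i, y i = ∑ i, d i`. -/
def IsOptimalAllocation {N : ℕ} (f : Fin N → ℝ → ℝ) (d y : Fin N → ℝ) : Prop :=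
  ∑ i, y i = ∑ i, d i ∧
    ∀ y' : Fin N → ℝ, ∑ i, y' i = ∑ i, d i → ∑ i, f i (y i) ≤ ∑ i, f i (y' i)

/-- Coordinates of the observer state in `ℝ^(2k+1)`: one constant mode and `k` planar modes. -/
abbrev ObsIndex (k : ℕ) : Type := Unit ⊕ (Fin 2 × Fin k)

/-- The block diagonal matrix with blocks `0` and `[0, freq j; -freq j, 0]`, `j = 1, …, k`. -/
def exoMatrix {k : ℕ} (freq : Fin k → ℝ) : Matrix (ObsIndex k) (ObsIndex k) ℝ :=
  Matrix.fromBlocks 0 0 0 (Matrix.blockDiagonal fun j => !![0, freq j; -freq j, 0])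

/-- The row `[1, 1, 0, …, 1, 0]`. -/
def obsRow (k : ℕ) : ObsIndex k → ℝ :=
  Sum.elim (fun _ => 1) (fun p => if p.1 = 0 then 1 else 0)

/-- The row `[1, 0, …, 1, 0]` of the disturbance modes; it does not see the constant mode, so its
entry there is `0`. -/
def distRow (k : ℕ) : ObsIndex k → ℝ :=
  Sum.elim (fun _ => 0) (fun p => if p.1 = 0 then 1 else 0)

/-- The observer matrix `S - L D`. -/
def observerMatrix {k : ℕ} (freq : Fin k → ℝ) (L : ObsIndex k → ℝ) :
    Matrix (ObsIndex k) (ObsIndex k) ℝ :=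
  exoMatrix freq - Matrix.vecMulVec L (obsRow k)

/-- All complex eigenvalues have negative real part. -/
def IsHurwitz {ι : Type} [Fintype ι] [DecidableEq ι] (A : Matrix ι ι ℝ) : Prop :=
  ∀ μ ∈ spectrum ℂ (A.map ((↑) : ℝ → ℂ)), μ.re < 0

/-- The observation `d(t) = d⁰ + ∑ j, A j * sin (freq j * t + φ j)`. -/
noncomputable def observation {k : ℕ} (d₀ : ℝ) (freq amp phase : Fin k → ℝ) (t : ℝ) : ℝ :=
  d₀ + ∑ j, amp j * Real.sin (freq j * t + phase j)

/-- States `(x, lam, η, z)` of the closed loop. -/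
abbrev LoopState {N : ℕ} (n k : Fin N → ℕ) : Type :=
  (∀ i, EuclideanSpace ℝ (Fin (n i))) × (Fin N → ℝ) × (∀ i, ObsIndex (k i) → ℝ) × (Fin N → ℝ)

/-- The right-hand side of the closed loop. `U` are the feedforward inputs, `d` the polluted
observations, `L` the observer gains:
`u = -γ y + lam + U y`, `lam' = -lamᵛ - zᵛ + d - y - Dᵋ η`, `η' = (S - L D) η + L d`,
`z' = lamᵛ`. -/
noncomputable def loopField {N : ℕ} (G : WeightedGraph N) {n k : Fin N → ℕ}
    (P : ∀ i, Agent (n i)) (U : Fin N → ℝ → ℝ) (freq : ∀ i, Fin (k i) → ℝ)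
    (L : ∀ i, ObsIndex (k i) → ℝ) (γ : ℝ) (d : Fin N → ℝ → ℝ) (t : ℝ) :
    LoopState n k → LoopState n k
  | (x, lam, η, z) =>
    (fun i => (P i).g (x i) (-γ * (P i).h (x i) + lam i + U i ((P i).h (x i))),
     fun i => -G.disagreement lam i - G.disagreement z i + d i t - (P i).h (x i)
        - distRow (k i) ⬝ᵥ η i,
     fun i => observerMatrix (freq i) (L i) *ᵥ η i + d i t • L i,
     fun i => G.disagreement lam i)

/-- `w` solves `w' = F t w` on the time set `I` (one-sided derivatives at end points). -/
def SolvesOn {E : Type} [NormedAddCommGroup E] [NormedSpace ℝ E]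
    (F : ℝ → E → E) (I : Set ℝ) (w : ℝ → E) : Prop :=
  ∀ t ∈ I, HasDerivWithinAt w (F t (w t)) I t

/-!
The optimal outputs all equal the average `m` of the `d₀ i`, and `G.disagreement zs = d₀ - m` is
solvable because the graph is connected. Let `W` be the sum of the passivity storages and the
quadratic energies of `lam - γ m` and `z - zs`, plus a constant. Passivity cancels the cross terms
between agents and multipliers, symmetry of the Laplacian cancels those between multipliers and
integrators, and the observer error decays exponentially, so
`W' ≤ -∑ i, (γ - M i) * (y i - m) ^ 2 + κ * exp (-b t) * W`. After multiplication by the integrating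
factor `exp (κ / b * exp (-b t))`, `W` is nonincreasing: solutions stay bounded, hence are global,
and `y i - m`, which is square integrable with bounded derivative, tends to zero.
-/

section LinearDecay

open Polynomial

variable {E : Type*} [NormedAddCommGroup E]

theorem norm_le_add_exp_of_norm_deriv_le [NormedSpace ℝ E] {q q' : ℝ → E} {K δ T : ℝ}
    (hδ : 0 < δ) (hq : ∀ t ∈ Icc 0 T, HasDerivWithinAt q (q' t) (Icc 0 T) t)
    (hq' : ∀ t ∈ Icc 0 T, ‖q' t‖ ≤ K * Real.exp (δ * t)) {t : ℝ} (ht : t ∈ Icc 0 T) :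
    ‖q t‖ ≤ ‖q 0‖ + K / δ * Real.exp (δ * t) := by
  have hK : 0 ≤ K :=
    nonneg_of_mul_nonneg_left ((norm_nonneg _).trans (hq' t ht)) (Real.exp_pos _)
  have hB (s : ℝ) : HasDerivAt (fun s => ‖q 0‖ + K / δ * Real.exp (δ * s))
      (K * Real.exp (δ * s)) s := by
    refine ((((hasDerivAt_id s).const_mul δ).exp.const_mul (K / δ)).const_add ‖q 0‖).congr_deriv ?_
    simp only [id]
    field_simp
  refine image_norm_le_of_norm_deriv_right_le_deriv_boundary
    (fun s hs => (hq s hs).continuousWithinAt)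
    (fun s hs => (hq s (Ico_subset_Icc_self hs)).mono_of_mem_nhdsWithin (Icc_mem_nhdsGE_of_mem hs))
    ?_ hB (fun s hs => hq' s (Ico_subset_Icc_self hs)) ht
  exact le_add_of_nonneg_right (by positivity)

variable [NormedSpace ℂ E]

theorem norm_le_exp_of_hasDerivWithinAt_smul_add {μ : ℂ} {b K T : ℝ}
    (hμ : b < -μ.re) {v r : ℝ → E}
    (hv : ∀ t ∈ Icc 0 T, HasDerivWithinAt v (μ • v t + r t) (Icc 0 T) t)
    (hr : ∀ t ∈ Icc 0 T, ‖r t‖ ≤ K * Real.exp (-b * t)) {t : ℝ} (ht : t ∈ Icc 0 T) :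
    ‖v t‖ ≤ (‖v 0‖ + K / (-μ.re - b)) * Real.exp (-b * t) := by
  have hnorm (s : ℝ) : ‖Complex.exp (-μ * s)‖ = Real.exp (-μ.re * s) := by
    simp [Complex.norm_exp]
  have hexp (s : ℝ) : HasDerivAt (fun s : ℝ => Complex.exp (-μ * s))
      (Complex.exp (-μ * s) * (-μ)) s := by
    simpa using ((Complex.ofRealCLM.hasDerivAt (x := s)).const_mul (-μ)).cexp
  have hq (s : ℝ) (hs : s ∈ Icc 0 T) : HasDerivWithinAt (fun s : ℝ => Complex.exp (-μ * s) • v s)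
      (Complex.exp (-μ * s) • r s) (Icc 0 T) s :=
    ((hexp s).hasDerivWithinAt.smul (hv s hs)).congr_deriv (by module)
  have hq' (s : ℝ) (hs : s ∈ Icc 0 T) :
      ‖Complex.exp (-μ * s) • r s‖ ≤ K * Real.exp ((-μ.re - b) * s) := by
    rw [norm_smul, hnorm]
    calc Real.exp (-μ.re * s) * ‖r s‖
        ≤ Real.exp (-μ.re * s) * (K * Real.exp (-b * s)) := by gcongr; exact hr s hs
      _ = K * Real.exp (-μ.re * s + -b * s) := by rw [Real.exp_add]; ring
      _ = K * Real.exp ((-μ.re - b) * s) := by ring_nf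
  have hbound : Real.exp (-μ.re * t) * ‖v t‖ ≤
      ‖v 0‖ + K / (-μ.re - b) * Real.exp ((-μ.re - b) * t) := by
    have h := norm_le_add_exp_of_norm_deriv_le (sub_pos.2 hμ) hq hq' ht
    rwa [norm_smul, norm_smul, hnorm, hnorm, mul_zero, Real.exp_zero, one_mul] at h
  calc ‖v t‖ = Real.exp (μ.re * t) * (Real.exp (-μ.re * t) * ‖v t‖) := by
        rw [← mul_assoc, ← Real.exp_add]; simp
    _ ≤ Real.exp (μ.re * t) *
          (‖v 0‖ + K / (-μ.re - b) * Real.exp ((-μ.re - b) * t)) := by gcongr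
    _ = ‖v 0‖ * Real.exp (μ.re * t) +
          K / (-μ.re - b) * Real.exp (μ.re * t + (-μ.re - b) * t) := by rw [Real.exp_add]; ring
    _ = ‖v 0‖ * Real.exp (μ.re * t) + K / (-μ.re - b) * Real.exp (-b * t) := by ring_nf
    _ ≤ ‖v 0‖ * Real.exp (-b * t) + K / (-μ.re - b) * Real.exp (-b * t) := by
        gcongr
        · exact ht.1
        · linarith
    _ = _ := by ring

theorem exists_decay_of_aeval_apply_eq_zero (A : E →L[ℂ] E) (s : Multiset ℂ)
    (hs : ∀ μ ∈ s, μ.re < 0) :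
    ∃ b K : ℝ, 0 < b ∧ 0 ≤ K ∧ ∀ (T : ℝ) (v : ℝ → E),
      (∀ t ∈ Icc 0 T, HasDerivWithinAt v (A (v t)) (Icc 0 T) t) →
      (∀ t ∈ Icc 0 T, aeval A (s.map fun μ => X - C μ).prod (v t) = 0) →
      ∀ t ∈ Icc 0 T, ‖v t‖ ≤ K * ‖v 0‖ * Real.exp (-b * t) := by
  induction s using Multiset.induction with
  | empty => exact ⟨1, 0, one_pos, le_rfl, fun T v _ h t ht => by simpa using h t ht⟩
  | cons μ s ih =>
    obtain ⟨b, K, hb, hK, ih⟩ := ih fun ν hν => hs ν (Multiset.mem_cons_of_mem hν)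
    have hμ : μ.re < 0 := hs μ (Multiset.mem_cons_self μ s)
    set Q : E →L[ℂ] E := A - μ • 1 with hQ
    have hQX : aeval A (X - C μ) = Q := by simp [hQ, Algebra.algebraMap_eq_smul_one]
    obtain ⟨c, hc, hcb, hcμ⟩ : ∃ c, 0 < c ∧ c ≤ b ∧ c < -μ.re :=
      ⟨min b (-μ.re / 2), lt_min hb (by linarith), min_le_left _ _,
        (min_le_right _ _).trans_lt (by linarith)⟩
    refine ⟨c, 1 + K * ‖Q‖ / (-μ.re - c), hc,
      add_nonneg zero_le_one (div_nonneg (by positivity) (by linarith)), fun T v hv h t ht => ?_⟩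
    have hQv (r : ℝ) (hr : r ∈ Icc 0 T) : ‖Q (v r)‖ ≤ K * (‖Q‖ * ‖v 0‖) * Real.exp (-c * r) := by
      have hder (r : ℝ) (hr : r ∈ Icc 0 T) :
          HasDerivWithinAt (fun r => Q (v r)) (A (Q (v r))) (Icc 0 T) r :=
        ((Q.restrictScalars ℝ).hasFDerivAt.comp_hasDerivWithinAt r (hv r hr)).congr_deriv
          (by simp [hQ])
      have hzero (r : ℝ) (hr : r ∈ Icc 0 T) :
          aeval A (s.map fun μ => X - C μ).prod (Q (v r)) = 0 := by
        rw [← h r hr, Multiset.map_cons, Multiset.prod_cons, mul_comm, map_mul, hQX,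
          mul_apply_eq_comp]
      refine (ih T _ hder hzero r hr).trans ?_
      have := hr.1
      gcongr
      exact Q.le_opNorm _
    refine (norm_le_exp_of_hasDerivWithinAt_smul_add (μ := μ) hcμ
      (r := fun r => Q (v r)) (fun r hr => (hv r hr).congr_deriv (by simp [hQ])) hQv ht).trans_eq ?_
    ring

theorem IsHurwitz.exists_decay {ι : Type} [Fintype ι] [DecidableEq ι] {A : Matrix ι ι ℝ}
    (hA : IsHurwitz A) :
    ∃ b K : ℝ, 0 < b ∧ 0 ≤ K ∧ ∀ (T : ℝ) (e : ℝ → ι → ℝ),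
      (∀ t ∈ Icc 0 T, HasDerivWithinAt e (A *ᵥ e t) (Icc 0 T) t) →
      ∀ t ∈ Icc 0 T, ‖e t‖ ≤ K * ‖e 0‖ * Real.exp (-b * t) := by
  set B : Matrix ι ι ℂ := A.map ((↑) : ℝ → ℂ) with hB
  let φ : Matrix ι ι ℂ ≃ₐ[ℂ] ((ι → ℂ) →L[ℂ] (ι → ℂ)) :=
    Matrix.toLinAlgEquiv'.trans (Module.End.toContinuousLinearMap (ι → ℂ))
  have hroots : ∀ μ ∈ B.charpoly.roots, μ.re < 0 := fun μ hμ =>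
    hA μ (Matrix.mem_spectrum_iff_isRoot_charpoly.2 (isRoot_of_mem_roots hμ))
  have hsplit : (B.charpoly.roots.map fun μ => X - C μ).prod = B.charpoly :=
    ((IsAlgClosed.splits B.charpoly).eq_prod_roots_of_monic B.charpoly_monic).symm
  have hcayley : aeval (φ B) (B.charpoly.roots.map fun μ => X - C μ).prod = 0 := by
    rw [hsplit, aeval_algHom_apply, Matrix.aeval_self_charpoly, map_zero]
  obtain ⟨b, K, hb, hK, h⟩ := exists_decay_of_aeval_apply_eq_zero (φ B) _ hroots
  refine ⟨b, K, hb, hK, fun T e he t ht => ?_⟩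
  have hφ (x : ι → ℂ) : φ B x = B *ᵥ x := rfl
  have hnorm (x : ι → ℝ) : ‖fun i => (x i : ℂ)‖ = ‖x‖ := by simp [Pi.norm_def]
  have hder (t : ℝ) (ht : t ∈ Icc 0 T) :
      HasDerivWithinAt (fun t i => (e t i : ℂ)) (φ B fun i => (e t i : ℂ)) (Icc 0 T) t :=
    hasDerivWithinAt_pi.2 fun i => ((hasDerivWithinAt_pi.1 (he t ht) i).ofReal_comp).congr_deriv <|
      by rw [hφ]; simp [Matrix.mulVec, dotProduct, hB]
  simpa only [hnorm] using h T _ hder (fun t _ => by rw [hcayley]; rfl) t ht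

end LinearDecay

theorem exists_mul_exp_neg_mul_le {ι : Type*} [Finite ι] {b κ : ι → ℝ} (hb : ∀ i, 0 < b i)
    (hκ : ∀ i, 0 ≤ κ i) : ∃ b' κ' : ℝ, 0 < b' ∧ 0 ≤ κ' ∧
      ∀ i t, 0 ≤ t → κ i * Real.exp (-b i * t) ≤ κ' * Real.exp (-b' * t) := by
  cases isEmpty_or_nonempty ι with
  | inl h => exact ⟨1, 0, one_pos, le_rfl, fun i => h.elim i⟩
  | inr h =>
    obtain ⟨i₀, hi₀⟩ := Finite.exists_min b
    obtain ⟨j₀, hj₀⟩ := Finite.exists_max κ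
    refine ⟨b i₀, κ j₀, hb i₀, hκ j₀, fun i t ht => ?_⟩
    have hκj := hκ j₀
    gcongr
    exacts [hj₀ i, hi₀ i]

section GlobalExistence

theorem le_of_bootstrap_Icc {f : ℝ → ℝ} {a b R R' : ℝ} (hf : ContinuousOn f (Icc a b))
    (ha : f a ≤ R') (hR : R < R')
    (hboot : ∀ t ∈ Icc a b, (∀ s ∈ Icc a t, f s ≤ R') → f t ≤ R) :
    ∀ t ∈ Icc a b, f t ≤ R' := by
  have hcross (t : ℝ) (ht : t ∈ Icc a b) (h : R' ≤ f t) : ∃ s ∈ Icc a t, f s = R' :=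
    intermediate_value_Icc ht.1 (hf.mono (Icc_subset_Icc_right ht.2)) ⟨ha, h⟩
  by_contra! ⟨t, ht, htR⟩
  obtain ⟨s, hs, hsR⟩ := hcross t ht htR.le
  obtain ⟨m, ⟨hm, hmR : f m = R'⟩, hmin⟩ :=
    (isCompact_Icc.of_isClosed_subset
      (hf.preimage_isClosed_of_isClosed isClosed_Icc isClosed_singleton)
      inter_subset_left).exists_isLeast ⟨s, ⟨hs.1, hs.2.trans ht.2⟩, hsR⟩
  refine (hboot m hm fun r hr => ?_).not_gt (hmR ▸ hR)
  by_contra! hrR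
  have hrb : r ∈ Icc a b := ⟨hr.1, hr.2.trans hm.2⟩
  obtain ⟨q, hq, hqR⟩ := hcross r hrb hrR.le
  have hmq : m ≤ q := hmin ⟨⟨hq.1, hq.2.trans hrb.2⟩, hqR⟩
  obtain rfl : r = m := hr.2.antisymm (hmq.trans hq.2)
  exact hrR.ne' hmR

variable {E : Type} [NormedAddCommGroup E] [NormedSpace ℝ E] {F : ℝ → E → E}

theorem SolvesOn.mono {I J : Set ℝ} {w : ℝ → E} (h : SolvesOn F J w) (hIJ : I ⊆ J) :
    SolvesOn F I w :=
  fun t ht => (h t (hIJ ht)).mono hIJ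

theorem SolvesOn.continuousOn {I : Set ℝ} {w : ℝ → E} (h : SolvesOn F I w) : ContinuousOn w I :=
  fun t ht => (h t ht).continuousWithinAt

theorem SolvesOn.congr {F' : ℝ → E → E} {I : Set ℝ} {w : ℝ → E} (h : SolvesOn F I w)
    (hFF' : ∀ t ∈ I, F t (w t) = F' t (w t)) : SolvesOn F' I w :=
  fun t ht => hFF' t ht ▸ h t ht

theorem exists_bounded_lipschitzWith_eqOn_closedBall [FiniteDimensional ℝ E]
    (hF : ContDiff ℝ 1 (Function.uncurry F)) {ρ : ℝ} (hρ : 0 < ρ) :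
    ∃ (H : ℝ → E → E) (K C : ℝ≥0), (∀ t, LipschitzWith K (H t)) ∧
      (∀ x, Continuous fun t => H t x) ∧ (∀ t x, ‖H t x‖ ≤ C) ∧
      ∀ t x, |t| ≤ ρ → ‖x‖ ≤ ρ → F t x = H t x := by
  let χ : ContDiffBump (0 : ℝ × E) := ⟨ρ, ρ + 1, hρ, by linarith⟩
  have hsmooth : ContDiff ℝ 1 fun p => χ p • Function.uncurry F p := χ.contDiff.smul hF
  have hsupp : HasCompactSupport fun p => χ p • Function.uncurry F p :=
    χ.hasCompactSupport.smul_right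
  obtain ⟨K, hK⟩ := hsmooth.lipschitzWith_of_hasCompactSupport hsupp one_ne_zero
  obtain ⟨C, hC⟩ := hsupp.exists_bound_of_continuous hsmooth.continuous
  have hC0 : 0 ≤ C := (norm_nonneg _).trans (hC 0)
  refine ⟨fun t x => χ (t, x) • F t x, K, ⟨C, hC0⟩, fun t => ?_, fun x => ?_,
    fun t x => hC (t, x), fun t x ht hx => ?_⟩
  · simpa [Function.comp_def] using hK.comp (LipschitzWith.prodMk_left t)
  · exact hsmooth.continuous.comp (Continuous.prodMk_left x)
  · have hmem : (t, x) ∈ Metric.closedBall 0 χ.rIn := by simp [Prod.norm_def, χ, ht, hx]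
    simp only [χ.one_of_mem_closedBall hmem, one_smul]

theorem SolvesOn.eqOn_Icc_of_lipschitzWith {K : ℝ≥0} (hF : ∀ t, LipschitzWith K (F t)) {T : ℝ}
    {v w : ℝ → E} (hv : SolvesOn F (Icc 0 T) v) (hw : SolvesOn F (Icc 0 T) w) (h0 : v 0 = w 0) :
    EqOn v w (Icc 0 T) := by
  have hder {u : ℝ → E} (hu : SolvesOn F (Icc 0 T) u) (t : ℝ) (ht : t ∈ Ico 0 T) :
      HasDerivWithinAt u (F t (u t)) (Ici t) t :=
    (hu t (Ico_subset_Icc_self ht)).mono_of_mem_nhdsWithin (Icc_mem_nhdsGE_of_mem ht)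
  exact ODE_solution_unique hF hv.continuousOn (hder hv) hw.continuousOn (hder hw) h0

theorem exists_solvesOn_Icc_of_lipschitzWith [CompleteSpace E] {K C : ℝ≥0}
    (hF : ∀ t, LipschitzWith K (F t)) (hcont : ∀ x, Continuous fun t => F t x)
    (hC : ∀ t x, ‖F t x‖ ≤ C) {T : ℝ} (hT : 0 ≤ T) (w₀ : E) :
    ∃ w : ℝ → E, w 0 = w₀ ∧ SolvesOn F (Icc 0 T) w := by
  have hPL : IsPicardLindelof F (tmin := 0) (tmax := T) ⟨0, le_rfl, hT⟩ w₀
      (C * T.toNNReal) 0 C K :=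
    { lipschitzOnWith := fun t _ => (hF t).lipschitzOnWith
      continuousOn := fun x _ => (hcont x).continuousOn
      norm_le := fun t _ x _ => hC t x
      mul_max_le := by simp [hT] }
  exact hPL.exists_eq_forall_mem_Icc_hasDerivWithinAt₀

variable [FiniteDimensional ℝ E]

theorem SolvesOn.eqOn_Icc (hF : ContDiff ℝ 1 (Function.uncurry F)) {T : ℝ} {v w : ℝ → E}
    (hv : SolvesOn F (Icc 0 T) v) (hw : SolvesOn F (Icc 0 T) w) (h0 : v 0 = w 0) :
    EqOn v w (Icc 0 T) := by
  obtain ⟨a, ha⟩ := isCompact_Icc.exists_bound_of_continuousOn hv.continuousOn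
  obtain ⟨b, hb⟩ := isCompact_Icc.exists_bound_of_continuousOn hw.continuousOn
  obtain ⟨H, K, -, hK, -, -, hFH⟩ :=
    exists_bounded_lipschitzWith_eqOn_closedBall hF (ρ := max 1 (max T (max a b))) (by positivity)
  have hT {t : ℝ} (ht : t ∈ Icc 0 T) : |t| ≤ max 1 (max T (max a b)) := by
    rw [abs_of_nonneg ht.1]
    simp [ht.2]
  exact eqOn_Icc_of_lipschitzWith hK
    (hv.congr fun t ht => hFH t _ (hT ht) (by simp [ha t ht]))
    (hw.congr fun t ht => hFH t _ (hT ht) (by simp [hb t ht])) h0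

theorem exists_solvesOn_Icc (hF : ContDiff ℝ 1 (Function.uncurry F)) {w₀ : E} {T R : ℝ}
    (hT : 0 ≤ T)
    (hR : ∀ τ ∈ Icc 0 T, ∀ w : ℝ → E, w 0 = w₀ → SolvesOn F (Icc 0 τ) w → ‖w τ‖ ≤ R) :
    ∃ w : ℝ → E, w 0 = w₀ ∧ SolvesOn F (Icc 0 T) w := by
  set ρ := max T (max R ‖w₀‖ + 1)
  have hRρ : max R ‖w₀‖ < ρ := (lt_add_one _).trans_le (le_max_right _ _)
  have hρ : 0 < ρ := ((norm_nonneg w₀).trans (le_max_right R _)).trans_lt hRρ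
  obtain ⟨H, K, C, hK, hcont, hC, hFH⟩ := exists_bounded_lipschitzWith_eqOn_closedBall hF hρ
  obtain ⟨w, hw0, hw⟩ := exists_solvesOn_Icc_of_lipschitzWith hK hcont hC hT w₀
  have hsolves {τ : ℝ} (hτ : τ ∈ Icc 0 T) (hb : ∀ s ∈ Icc 0 τ, ‖w s‖ ≤ ρ) :
      SolvesOn F (Icc 0 τ) w :=
    (hw.mono (Icc_subset_Icc_right hτ.2)).congr fun s hs => (hFH s _
      (by rw [abs_of_nonneg hs.1]; exact (hs.2.trans hτ.2).trans (le_max_left _ _)) (hb s hs)).symm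
  have hbound : ∀ t ∈ Icc 0 T, ‖w t‖ ≤ ρ :=
    le_of_bootstrap_Icc hw.continuousOn.norm (by rw [hw0]; exact (le_max_right _ _).trans hRρ.le)
      hRρ fun t ht hb => (hR t ht w hw0 (hsolves ht hb)).trans (le_max_left _ _)
  exact ⟨w, hw0, hsolves ⟨hT, le_rfl⟩ hbound⟩

theorem exists_solvesOn_Ici (hF : ContDiff ℝ 1 (Function.uncurry F)) {w₀ : E}
    (hR : ∀ T, ∃ R, ∀ τ ∈ Icc 0 T, ∀ w : ℝ → E, w 0 = w₀ → SolvesOn F (Icc 0 τ) w → ‖w τ‖ ≤ R) :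
    ∃ w : ℝ → E, w 0 = w₀ ∧ SolvesOn F (Ici 0) w := by
  have hex (m : ℕ) : ∃ w : ℝ → E, w 0 = w₀ ∧ SolvesOn F (Icc 0 m) w :=
    let ⟨_, hR⟩ := hR m
    exists_solvesOn_Icc hF m.cast_nonneg hR
  choose w hw0 hw using hex
  have hagree {m m' : ℕ} {t : ℝ} (ht : 0 ≤ t) (hm : t ≤ m) (hm' : t ≤ m') : w m t = w m' t :=
    SolvesOn.eqOn_Icc hF ((hw m).mono (Icc_subset_Icc_right hm))
      ((hw m').mono (Icc_subset_Icc_right hm')) ((hw0 m).trans (hw0 m').symm) ⟨ht, le_rfl⟩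
  refine ⟨fun t => w ⌈t⌉₊ t, by simp [hw0], fun t ht => ?_⟩
  obtain ⟨m, hm⟩ := exists_nat_gt t
  have htm : w ⌈t⌉₊ t = w m t := hagree ht (Nat.le_ceil t) hm.le
  have hder : HasDerivWithinAt (w m) (F t (w m t)) (Ici 0) t :=
    (hw m t ⟨ht, hm.le⟩).mono_of_mem_nhdsWithin <| by
      rw [← Ici_inter_Iic]
      exact inter_mem self_mem_nhdsWithin (mem_nhdsWithin_of_mem_nhds (Iic_mem_nhds hm))
  simp only [htm]
  refine hder.congr_of_eventuallyEq ?_ htm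
  filter_upwards [self_mem_nhdsWithin, mem_nhdsWithin_of_mem_nhds (Iio_mem_nhds hm)] with s hs hsm
  exact hagree hs (Nat.le_ceil s) (le_of_lt hsm)

end GlobalExistence

section Dissipation

theorem antitoneOn_of_forall_hasDerivWithinAt_nonpos {D : Set ℝ} {f f' : ℝ → ℝ}
    (hD : Convex ℝ D) (hf : ∀ t ∈ D, HasDerivWithinAt f (f' t) D t) (hf' : ∀ t ∈ D, f' t ≤ 0) :
    AntitoneOn f D :=
  antitoneOn_of_hasDerivWithinAt_nonpos hD (fun t ht => (hf t ht).continuousWithinAt)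
    (fun t ht => (hf t (interior_subset ht)).mono interior_subset)
    fun t ht => hf' t (interior_subset ht)

theorem exists_tendsto_of_antitoneOn_Ici {f : ℝ → ℝ} {a m : ℝ} (hf : AntitoneOn f (Ici a))
    (hm : ∀ t ∈ Ici a, m ≤ f t) : ∃ l, Tendsto f atTop (𝓝 l) := by
  have hanti : Antitone fun t => f (max a t) := fun s t hst =>
    hf (le_max_left a s) (le_max_left a t) (max_le_max le_rfl hst)
  refine ⟨_, (tendsto_atTop_ciInf hanti ⟨m, ?_⟩).congr' ?_⟩
  · rintro _ ⟨t, rfl⟩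
    exact hm _ (le_max_left a t)
  · filter_upwards [eventually_ge_atTop a] with t ht
    rw [max_eq_right ht]

theorem nonpos_of_tendsto_of_deriv_le_neg {W W' h : ℝ → ℝ} {l : ℝ}
    (hW : ∀ t ∈ Ici 0, HasDerivWithinAt W (W' t) (Ici 0) t) (hW0 : ∀ t ∈ Ici 0, 0 ≤ W t)
    (hle : ∀ t ∈ Ici 0, W' t ≤ -h t) (hl : Tendsto h atTop (𝓝 l)) : l ≤ 0 := by
  by_contra! hpos
  obtain ⟨a, ha⟩ := eventually_atTop.1 (hl.eventually_const_lt (half_lt_self hpos))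
  set b := max a 0
  have hsub : Ici b ⊆ Ici (0 : ℝ) := Ici_subset_Ici.2 (le_max_right a 0)
  have hanti : AntitoneOn (fun t => W t + l / 2 * t) (Ici b) :=
    antitoneOn_of_forall_hasDerivWithinAt_nonpos (convex_Ici b)
      (fun t ht => ((hW t (hsub ht)).mono hsub).add ((hasDerivWithinAt_id t _).const_mul (l / 2)))
      fun t ht => by linarith [hle t (hsub ht), ha t ((le_max_left a 0).trans ht)]
  have htop : Tendsto (fun t => l / 2 * t) atTop atTop :=
    tendsto_id.const_mul_atTop (half_pos hpos)
  obtain ⟨t, ht, htb⟩ := ((htop.eventually_gt_atTop (W b + l / 2 * b)).and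
    (eventually_ge_atTop b)).exists
  linarith [hanti self_mem_Ici htb htb, hW0 t (hsub htb)]

-- `f ^ 3 ± (3 K / c) W` are monotone in opposite directions, so `f ^ 3` converges.
theorem exists_tendsto_pow_three_of_deriv_le_neg_sq {W W' f f' : ℝ → ℝ} {c K : ℝ} (hc : 0 < c)
    (hW : ∀ t ∈ Ici 0, HasDerivWithinAt W (W' t) (Ici 0) t)
    (hW0 : ∀ t ∈ Ici 0, 0 ≤ W t) (hle : ∀ t ∈ Ici 0, W' t ≤ -(c * f t ^ 2))
    (hf : ∀ t ∈ Ici 0, HasDerivWithinAt f (f' t) (Ici 0) t) (hf' : ∀ t ∈ Ici 0, |f' t| ≤ K) :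
    ∃ l, Tendsto (fun t => f t ^ 3) atTop (𝓝 l) := by
  have hK : 0 ≤ K := (abs_nonneg _).trans (hf' 0 self_mem_Ici)
  set m := 3 * K / c with hm
  have hm0 : 0 ≤ m := by positivity
  have hmc : m * c = 3 * K := by rw [hm]; field_simp
  have hderiv (t : ℝ) (ht : t ∈ Ici 0) : |3 * f t ^ 2 * f' t| ≤ -(m * W' t) := by
    calc |3 * f t ^ 2 * f' t| = 3 * f t ^ 2 * |f' t| := by
          rw [abs_mul, abs_of_nonneg (by positivity)]
      _ ≤ 3 * f t ^ 2 * K := by gcongr; exact hf' t ht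
      _ = m * (c * f t ^ 2) := by linear_combination -f t ^ 2 * hmc
      _ ≤ m * -W' t := by gcongr; linarith [hle t ht]
      _ = -(m * W' t) := mul_neg _ _
  have hcube (t : ℝ) (ht : t ∈ Ici 0) :
      HasDerivWithinAt (fun t => f t ^ 3) (3 * f t ^ 2 * f' t) (Ici 0) t := (hf t ht).pow 3
  have hplus : AntitoneOn (fun t => m * W t + f t ^ 3) (Ici 0) :=
    antitoneOn_of_forall_hasDerivWithinAt_nonpos (convex_Ici 0)
      (fun t ht => ((hW t ht).const_mul m).add (hcube t ht))
      fun t ht => by linarith [le_of_abs_le (hderiv t ht)]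
  have hminus : AntitoneOn (fun t => m * W t - f t ^ 3) (Ici 0) :=
    antitoneOn_of_forall_hasDerivWithinAt_nonpos (convex_Ici 0)
      (fun t ht => ((hW t ht).const_mul m).sub (hcube t ht))
      fun t ht => by linarith [neg_le_of_abs_le (hderiv t ht)]
  obtain ⟨p, hp⟩ := exists_tendsto_of_antitoneOn_Ici hplus (m := -(m * W 0 - f 0 ^ 3))
    fun t ht => by
      linarith [hminus self_mem_Ici ht ht, mul_nonneg hm0 (hW0 t ht)]
  obtain ⟨q, hq⟩ := exists_tendsto_of_antitoneOn_Ici hminus (m := -(m * W 0 + f 0 ^ 3))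
    fun t ht => by
      linarith [hplus self_mem_Ici ht ht, mul_nonneg hm0 (hW0 t ht)]
  exact ⟨(p - q) / 2, ((hp.sub hq).div_const 2).congr fun t => by ring⟩

theorem tendsto_zero_of_deriv_le_neg_sq {W W' f f' : ℝ → ℝ} {c K : ℝ} (hc : 0 < c)
    (hW : ∀ t ∈ Ici 0, HasDerivWithinAt W (W' t) (Ici 0) t)
    (hW0 : ∀ t ∈ Ici 0, 0 ≤ W t) (hle : ∀ t ∈ Ici 0, W' t ≤ -(c * f t ^ 2))
    (hf : ∀ t ∈ Ici 0, HasDerivWithinAt f (f' t) (Ici 0) t) (hf' : ∀ t ∈ Ici 0, |f' t| ≤ K) :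
    Tendsto f atTop (𝓝 0) := by
  obtain ⟨l, hl⟩ := exists_tendsto_pow_three_of_deriv_le_neg_sq hc hW hW0 hle hf hf'
  have habs : Tendsto (fun t => |f t|) atTop (𝓝 (|l| ^ (3⁻¹ : ℝ))) := by
    refine (hl.abs.rpow_const (.inr (by norm_num : (0 : ℝ) ≤ 3⁻¹))).congr fun t => ?_
    rw [abs_pow]
    exact_mod_cast Real.pow_rpow_inv_natCast (abs_nonneg (f t)) three_ne_zero
  have hsq : Tendsto (fun t => c * f t ^ 2) atTop (𝓝 (c * (|l| ^ (3⁻¹ : ℝ)) ^ 2)) := by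
    simpa only [sq_abs] using (habs.pow 2).const_mul c
  have hzero : (|l| ^ (3⁻¹ : ℝ)) ^ 2 ≤ 0 := by
    have := nonpos_of_tendsto_of_deriv_le_neg hW hW0 hle hsq
    nlinarith
  rw [pow_eq_zero_iff two_ne_zero |>.1 (hzero.antisymm (sq_nonneg _))] at habs
  exact (tendsto_zero_iff_abs_tendsto_zero f).2 habs

theorem hasDerivWithinAt_mul_exp_exp {W : ℝ → ℝ} {W' b κ t : ℝ} {D : Set ℝ} (hb : b ≠ 0)
    (hW : HasDerivWithinAt W W' D t) :
    HasDerivWithinAt (fun t => W t * Real.exp (κ / b * Real.exp (-b * t)))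
      ((W' - κ * Real.exp (-b * t) * W t) * Real.exp (κ / b * Real.exp (-b * t))) D t := by
  have hexp := ((hasDerivWithinAt_id t D).const_mul (-b)).exp.const_mul (κ / b) |>.exp
  refine (hW.mul hexp).congr_deriv ?_
  simp only [id]
  field_simp
  ring

theorem le_of_deriv_le_exp_mul {W W' : ℝ → ℝ} {b κ T : ℝ} (hb : 0 < b) (hκ : 0 ≤ κ)
    (hW : ∀ t ∈ Icc 0 T, HasDerivWithinAt W (W' t) (Icc 0 T) t) (hW0 : ∀ t ∈ Icc 0 T, 0 ≤ W t)
    (hle : ∀ t ∈ Icc 0 T, W' t ≤ κ * Real.exp (-b * t) * W t) {t : ℝ} (ht : t ∈ Icc 0 T) :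
    W t ≤ W 0 * Real.exp (κ / b) := by
  have hanti : AntitoneOn (fun t => W t * Real.exp (κ / b * Real.exp (-b * t))) (Icc 0 T) :=
    antitoneOn_of_forall_hasDerivWithinAt_nonpos (convex_Icc 0 T)
      (fun t ht => hasDerivWithinAt_mul_exp_exp hb.ne' (hW t ht))
      fun t ht => mul_nonpos_of_nonpos_of_nonneg (sub_nonpos.2 (hle t ht)) (Real.exp_nonneg _)
  calc W t ≤ W t * Real.exp (κ / b * Real.exp (-b * t)) :=
        le_mul_of_one_le_right (hW0 t ht) (Real.one_le_exp (by positivity))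
    _ ≤ W 0 * Real.exp (κ / b * Real.exp (-b * 0)) := hanti ⟨le_rfl, ht.1.trans ht.2⟩ ht ht.1
    _ = W 0 * Real.exp (κ / b) := by simp

theorem tendsto_zero_of_deriv_le_neg_sq_add_exp_mul {W W' f f' : ℝ → ℝ} {b c κ K : ℝ}
    (hb : 0 < b) (hc : 0 < c) (hκ : 0 ≤ κ)
    (hW : ∀ t ∈ Ici 0, HasDerivWithinAt W (W' t) (Ici 0) t) (hW0 : ∀ t ∈ Ici 0, 0 ≤ W t)
    (hle : ∀ t ∈ Ici 0, W' t ≤ -(c * f t ^ 2) + κ * Real.exp (-b * t) * W t)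
    (hf : ∀ t ∈ Ici 0, HasDerivWithinAt f (f' t) (Ici 0) t) (hf' : ∀ t ∈ Ici 0, |f' t| ≤ K) :
    Tendsto f atTop (𝓝 0) := by
  refine tendsto_zero_of_deriv_le_neg_sq hc
    (fun t ht => hasDerivWithinAt_mul_exp_exp (κ := κ) hb.ne' (hW t ht))
    (fun t ht => mul_nonneg (hW0 t ht) (Real.exp_nonneg _)) (fun t ht => ?_) hf hf'
  calc (W' t - κ * Real.exp (-b * t) * W t) * Real.exp (κ / b * Real.exp (-b * t))
      ≤ -(c * f t ^ 2) * Real.exp (κ / b * Real.exp (-b * t)) := by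
        gcongr
        linarith [hle t ht]
    _ ≤ -(c * f t ^ 2) :=
        mul_le_of_one_le_right (by simpa using by positivity) (Real.one_le_exp (by positivity))

end Dissipation

namespace WeightedGraph

variable {N : ℕ} (G : WeightedGraph N)

/-- The weighted graph Laplacian, the matrix of the linear map `v ↦ G.disagreement v`. -/
def laplacian : Matrix (Fin N) (Fin N) ℝ :=
  Matrix.diagonal (fun i => ∑ j, G.weight i j) - Matrix.of G.weight

theorem laplacian_mulVec (v : Fin N → ℝ) : G.laplacian *ᵥ v = G.disagreement v := by
  funext i
  rw [laplacian, Matrix.sub_mulVec, Pi.sub_apply, Matrix.mulVec_diagonal]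
  simp [disagreement, Matrix.mulVec, dotProduct, mul_sub, Finset.sum_mul]

theorem isSymm_laplacian : G.laplacian.IsSymm := by
  rw [Matrix.IsSymm, laplacian, Matrix.transpose_sub, Matrix.diagonal_transpose]
  congr
  ext i j
  exact G.weight_symm i j

theorem disagreement_sub (v w : Fin N → ℝ) :
    G.disagreement (v - w) = G.disagreement v - G.disagreement w := by
  simp only [← laplacian_mulVec, Matrix.mulVec_sub]

theorem disagreement_const (c : ℝ) : G.disagreement (fun _ => c) = 0 := by
  funext i
  simp [disagreement]

theorem contDiff_disagreement {m : WithTop ℕ∞} : ContDiff ℝ m G.disagreement := by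
  unfold disagreement
  fun_prop

theorem dotProduct_disagreement_comm (v w : Fin N → ℝ) :
    v ⬝ᵥ G.disagreement w = w ⬝ᵥ G.disagreement v := by
  rw [← laplacian_mulVec, ← laplacian_mulVec, Matrix.dotProduct_mulVec, dotProduct_comm,
    ← Matrix.mulVec_transpose, G.isSymm_laplacian]

theorem two_mul_dotProduct_disagreement_self (v : Fin N → ℝ) :
    2 * (v ⬝ᵥ G.disagreement v) = ∑ i, ∑ j, G.weight i j * (v i - v j) ^ 2 := by
  have hleft : v ⬝ᵥ G.disagreement v = ∑ i, ∑ j, G.weight i j * (v i * (v i - v j)) := by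
    simp only [dotProduct, disagreement, Finset.mul_sum]
    congr! 2
    ring
  have hright : v ⬝ᵥ G.disagreement v = ∑ i, ∑ j, G.weight i j * (v j * (v j - v i)) := by
    rw [hleft, Finset.sum_comm]
    simp only [fun i j => G.weight_symm j i]
  calc 2 * (v ⬝ᵥ G.disagreement v) = v ⬝ᵥ G.disagreement v + v ⬝ᵥ G.disagreement v := two_mul _
    _ = ∑ i, ∑ j, (G.weight i j * (v i * (v i - v j)) + G.weight i j * (v j * (v j - v i))) := by
        simp only [Finset.sum_add_distrib]
        rw [← hleft, ← hright]
    _ = ∑ i, ∑ j, G.weight i j * (v i - v j) ^ 2 := by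
        congr! 2
        ring

theorem dotProduct_disagreement_self_nonneg (v : Fin N → ℝ) : 0 ≤ v ⬝ᵥ G.disagreement v := by
  have hsum : 0 ≤ ∑ i, ∑ j, G.weight i j * (v i - v j) ^ 2 :=
    Finset.sum_nonneg fun i _ => Finset.sum_nonneg fun j _ =>
      mul_nonneg (G.weight_nonneg i j) (sq_nonneg _)
  linarith [G.two_mul_dotProduct_disagreement_self v]

theorem sum_multiplier_supply_le
    {lam z zs y p q : Fin N → ℝ} {lam₀ : ℝ} (hzs : G.disagreement zs = p) :
    ∑ i, ((lam i - lam₀) * (-G.disagreement lam i - G.disagreement z i + q i - y i)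
        + (z i - zs i) * G.disagreement lam i) ≤
      ∑ i, (lam i - lam₀) * (q i - p i - y i) := by
  set l := lam - fun _ => lam₀
  have hl : G.disagreement l = G.disagreement lam := by
    rw [disagreement_sub, disagreement_const, sub_zero]
  have hz : G.disagreement (z - zs) = G.disagreement z - p := by rw [disagreement_sub, hzs]
  calc ∑ i, ((lam i - lam₀) * (-G.disagreement lam i - G.disagreement z i + q i - y i)
        + (z i - zs i) * G.disagreement lam i)
      = ∑ i, (lam i - lam₀) * (q i - p i - y i) - l ⬝ᵥ G.disagreement l
          - l ⬝ᵥ G.disagreement (z - zs) + (z - zs) ⬝ᵥ G.disagreement l := by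
        simp only [hl, hz, dotProduct, ← Finset.sum_sub_distrib, ← Finset.sum_add_distrib]
        refine Finset.sum_congr rfl fun i _ => ?_
        simp only [l, Pi.sub_apply]
        ring
    _ ≤ ∑ i, (lam i - lam₀) * (q i - p i - y i) := by
        linarith [G.dotProduct_disagreement_comm l (z - zs),
          G.dotProduct_disagreement_self_nonneg l]

theorem eq_of_disagreement_eq_zero (hG : G.toSimpleGraph.Connected) {v : Fin N → ℝ}
    (hv : G.disagreement v = 0) (i j : Fin N) : v i = v j := by
  have hnonneg (i j : Fin N) : 0 ≤ G.weight i j * (v i - v j) ^ 2 :=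
    mul_nonneg (G.weight_nonneg i j) (sq_nonneg _)
  have hsum : ∑ i, ∑ j, G.weight i j * (v i - v j) ^ 2 = 0 := by
    rw [← two_mul_dotProduct_disagreement_self, hv, dotProduct_zero, mul_zero]
  have hadj (a b : Fin N) (hab : 0 < G.weight a b) : v a = v b := by
    have hrow := (Finset.sum_eq_zero_iff_of_nonneg
      fun i _ => Finset.sum_nonneg fun j _ => hnonneg i j).1 hsum a (Finset.mem_univ a)
    have hentry := (Finset.sum_eq_zero_iff_of_nonneg
      fun j _ => hnonneg a j).1 hrow b (Finset.mem_univ b)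
    exact sub_eq_zero.1 (pow_eq_zero_iff two_ne_zero |>.1
      ((mul_eq_zero.1 hentry).resolve_left hab.ne'))
  obtain ⟨p⟩ := hG.preconnected i j
  induction p with
  | nil => rfl
  | cons hab _ ih => exact (hadj _ _ hab).trans ih

-- The Laplacian is symmetric, so its range is the orthogonal complement of its kernel.
theorem exists_disagreement_eq (hG : G.toSimpleGraph.Connected) {b : Fin N → ℝ}
    (hb : ∑ i, b i = 0) : ∃ z : Fin N → ℝ, G.disagreement z = b := by
  have hsymm : G.laplacian.toEuclideanLin.IsSymmetric :=
    Matrix.isSymmetric_toEuclideanLin_iff.2 ((Matrix.conjTranspose_eq_transpose_of_trivial _).trans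
      G.isSymm_laplacian)
  obtain ⟨z, hz⟩ : WithLp.toLp 2 b ∈ LinearMap.range G.laplacian.toEuclideanLin := by
    rw [← Submodule.orthogonal_orthogonal (LinearMap.range _), hsymm.orthogonal_range,
      Submodule.mem_orthogonal]
    intro u hu
    have hu0 : G.disagreement u = 0 := by
      rw [← laplacian_mulVec]
      exact congrArg WithLp.ofLp (LinearMap.mem_ker.1 hu)
    obtain ⟨i₀⟩ := hG.nonempty
    calc inner ℝ u (WithLp.toLp 2 b) = ∑ i, b i * u i := by simp [PiLp.inner_apply]
      _ = ∑ i, b i * u i₀ := by simp only [G.eq_of_disagreement_eq_zero hG hu0 _ i₀]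
      _ = 0 := by rw [← Finset.sum_mul, hb, zero_mul]
  exact ⟨z, (G.laplacian_mulVec z).symm.trans (congrArg WithLp.ofLp hz)⟩

end WeightedGraph

theorem IsOptimalAllocation.eq_average {N : ℕ} {d y : Fin N → ℝ}
    (h : IsOptimalAllocation (fun _ s => s ^ 2 / 2) d y) (i : Fin N) :
    y i = (1 / (N : ℝ)) * ∑ j, d j := by
  have hN : (N : ℝ) ≠ 0 := Nat.cast_ne_zero.2 i.pos.ne'
  set m := (1 / (N : ℝ)) * ∑ j, d j with hm
  have hNm : ∑ j, d j = N * m := by rw [hm]; field_simp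
  have hmin : ∑ i, y i ^ 2 / 2 ≤ ∑ _i : Fin N, m ^ 2 / 2 := h.2 (fun _ => m) (by simp [hNm])
  have hexpand : ∑ i, (y i - m) ^ 2 =
      2 * ∑ i, y i ^ 2 / 2 - 2 * m * ∑ i, y i + ∑ _i : Fin N, m ^ 2 := by
    simp only [Finset.mul_sum, ← Finset.sum_sub_distrib, ← Finset.sum_add_distrib]
    congr! 1
    ring
  have hle : ∑ i, (y i - m) ^ 2 ≤ 0 := by
    rw [hexpand, h.1, hNm]
    simp only [Finset.sum_const, Finset.card_univ, Fintype.card_fin, nsmul_eq_mul] at hmin ⊢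
    linarith
  have hzero := (Finset.sum_eq_zero_iff_of_nonneg fun i _ => sq_nonneg (y i - m)).1
    (hle.antisymm (Finset.sum_nonneg fun i _ => sq_nonneg _)) i (Finset.mem_univ i)
  exact sub_eq_zero.1 (pow_eq_zero_iff two_ne_zero |>.1 hzero)

section Observer

variable {k : ℕ} {d₀ : ℝ} {freq amp phase : Fin k → ℝ}

theorem contDiff_observation {m : WithTop ℕ∞} : ContDiff ℝ m (observation d₀ freq amp phase) := by
  unfold observation
  fun_prop

/-- The exosystem state that generates the observation: the constant mode carries `d₀`, and the
planar modes carry the sinusoids together with their quadratures. -/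
noncomputable def exoState (d₀ : ℝ) (freq amp phase : Fin k → ℝ) (t : ℝ) : ObsIndex k → ℝ :=
  Sum.elim (fun _ => d₀) fun p =>
    if p.1 = 0 then amp p.2 * Real.sin (freq p.2 * t + phase p.2)
    else amp p.2 * Real.cos (freq p.2 * t + phase p.2)

theorem distRow_dotProduct_exoState (t : ℝ) :
    distRow k ⬝ᵥ exoState d₀ freq amp phase t = observation d₀ freq amp phase t - d₀ := by
  simp [dotProduct, distRow, exoState, observation, Fintype.sum_prod_type]

theorem obsRow_dotProduct_exoState (t : ℝ) :
    obsRow k ⬝ᵥ exoState d₀ freq amp phase t = observation d₀ freq amp phase t := by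
  simp [dotProduct, obsRow, exoState, observation, Fintype.sum_prod_type]

theorem hasDerivAt_exoState (t : ℝ) :
    HasDerivAt (exoState d₀ freq amp phase) (exoMatrix freq *ᵥ exoState d₀ freq amp phase t) t := by
  have harg (j : Fin k) : HasDerivAt (fun t => freq j * t + phase j) (freq j) t := by
    simpa using ((hasDerivAt_id t).const_mul (freq j)).add_const (phase j)
  rw [hasDerivAt_pi]
  rintro (_ | ⟨a, j⟩)
  · refine (hasDerivAt_const t d₀).congr_deriv ?_
    simp [exoMatrix, Matrix.mulVec, dotProduct]
  · fin_cases a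
    · refine ((harg j).sin.const_mul (amp j)).congr_deriv ?_
      simp [exoMatrix, Matrix.mulVec, dotProduct, Matrix.blockDiagonal_apply, exoState,
        Fintype.sum_prod_type]
      ring
    · refine ((harg j).cos.const_mul (amp j)).congr_deriv ?_
      simp [exoMatrix, Matrix.mulVec, dotProduct, Matrix.blockDiagonal_apply, exoState,
        Fintype.sum_prod_type]
      ring

theorem continuous_exoState : Continuous (exoState d₀ freq amp phase) :=
  continuous_iff_continuousAt.2 fun t => (hasDerivAt_exoState t).continuousAt

theorem hasDerivWithinAt_observer_error {L : ObsIndex k → ℝ} {η : ℝ → ObsIndex k → ℝ}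
    {I : Set ℝ} {t : ℝ}
    (h : HasDerivWithinAt η (observerMatrix freq L *ᵥ η t +
      observation d₀ freq amp phase t • L) I t) :
    HasDerivWithinAt (η - exoState d₀ freq amp phase)
      (observerMatrix freq L *ᵥ (η - exoState d₀ freq amp phase) t) I t := by
  refine (h.sub (hasDerivAt_exoState t).hasDerivWithinAt).congr_deriv ?_
  rw [Pi.sub_apply, Matrix.mulVec_sub, observerMatrix,
    Matrix.sub_mulVec _ _ (exoState d₀ freq amp phase t), Matrix.vecMulVec_mulVec,
    obsRow_dotProduct_exoState]
  ext p
  simp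
  ring

theorem exists_norm_observer_error_le {L : ObsIndex k → ℝ}
    (hL : IsHurwitz (observerMatrix freq L)) (η₀ : ObsIndex k → ℝ) :
    ∃ b κ, 0 < b ∧ 0 ≤ κ ∧ ∀ T, ∀ η : ℝ → ObsIndex k → ℝ, η 0 = η₀ →
      SolvesOn (fun t η => observerMatrix freq L *ᵥ η + observation d₀ freq amp phase t • L)
        (Icc 0 T) η →
      ∀ t ∈ Icc 0 T, ‖η t - exoState d₀ freq amp phase t‖ ≤ κ * Real.exp (-b * t) := by
  obtain ⟨b, K, hb, hK, hdecay⟩ := hL.exists_decay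
  refine ⟨b, K * ‖η₀ - exoState d₀ freq amp phase 0‖, hb, by positivity, ?_⟩
  rintro T η rfl hη t ht
  exact hdecay T _ (fun s hs => hasDerivWithinAt_observer_error (hη s hs)) t ht

theorem abs_disturbance_error_le (η : ObsIndex k → ℝ) (t : ℝ) :
    |observation d₀ freq amp phase t - d₀ - distRow k ⬝ᵥ η| ≤
      (∑ p, |distRow k p|) * ‖η - exoState d₀ freq amp phase t‖ := by
  rw [← distRow_dotProduct_exoState, ← dotProduct_sub, dotProduct, Finset.sum_mul]
  refine (Finset.abs_sum_le_sum_abs _ _).trans (Finset.sum_le_sum fun p _ => ?_)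
  rw [abs_mul, norm_sub_rev]
  exact mul_le_mul_of_nonneg_left
    (norm_le_pi_norm (exoState d₀ freq amp phase t - η) p) (abs_nonneg _)

end Observer

section Passivity

namespace Agent

variable {n : ℕ} {P : Agent n} {U : ℝ → ℝ} {V : EuclideanSpace ℝ (Fin n) → ℝ}

/-- `V` is a proper storage function that certifies passivity of the agent with respect to the
steady-state output `m` and the steady-state input `us`. -/
structure IsStorage (P : Agent n) (m us : ℝ) (V : EuclideanSpace ℝ (Fin n) → ℝ) : Prop where
  differentiable : Differentiable ℝ V
  nonneg : ∀ x, 0 ≤ V x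
  exists_norm_le : ∀ W, ∃ R, ∀ x, V x ≤ W → ‖x‖ ≤ R
  dissipation : ∀ x u, fderiv ℝ V x (P.g x u) ≤ (P.h x - m) * (u - us)

theorem PassiveAt.exists_isStorage {xs : EuclideanSpace ℝ (Fin n)} {us : ℝ}
    (h : P.PassiveAt xs us) : ∃ V, P.IsStorage (P.h xs) us V := by
  obtain ⟨V, α, _, hV, hα, -, hαV, hdiss⟩ := h
  refine ⟨V, hV.differentiable one_ne_zero, fun x => ?_, fun W => ?_, hdiss⟩
  · calc 0 = α 0 := hα.map_zero.symm
      _ ≤ α ‖x - xs‖ := hα.strictMonoOn.monotoneOn self_mem_Ici (norm_nonneg _) (norm_nonneg _)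
      _ ≤ V x := (hαV x).1
  · obtain ⟨r, hr⟩ := eventually_atTop.1 (hα.tendsto_atTop.eventually_gt_atTop W)
    refine ⟨‖xs‖ + r, fun x hx => ?_⟩
    have hxr : ‖x - xs‖ < r := by
      by_contra! hle
      exact ((hr _ hle).trans_le ((hαV x).1.trans hx)).false
    exact (norm_le_norm_add_norm_sub' x xs).trans (by gcongr)

/-- The vector field of the agent under the control `u = -γ y + lam + U y`. -/
noncomputable def feedback (P : Agent n) (U : ℝ → ℝ) (γ lam : ℝ) (x : EuclideanSpace ℝ (Fin n)) :
    EuclideanSpace ℝ (Fin n) :=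
  P.g x (-γ * P.h x + lam + U (P.h x))

theorem IsStorage.fderiv_feedback_le {m μ γ lam : ℝ} {x : EuclideanSpace ℝ (Fin n)}
    (hV : P.IsStorage m (U m) V)
    (hU : (P.h x - m) * (U (P.h x) - U m) ≤ μ * (P.h x - m) ^ 2) :
    fderiv ℝ V x (P.feedback U γ lam x) ≤
      -((γ - μ) * (P.h x - m) ^ 2) + (P.h x - m) * (lam - γ * m) :=
  calc fderiv ℝ V x (P.feedback U γ lam x)
      ≤ (P.h x - m) * (-γ * P.h x + lam + U (P.h x) - U m) := hV.dissipation x _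
    _ = -(γ * (P.h x - m) ^ 2) + (P.h x - m) * (U (P.h x) - U m)
        + (P.h x - m) * (lam - γ * m) := by ring
    _ ≤ -((γ - μ) * (P.h x - m) ^ 2) + (P.h x - m) * (lam - γ * m) := by linarith

theorem exists_abs_fderiv_output_feedback_le (P : Agent n) (hU : Continuous U) (γ R : ℝ) :
    ∃ K, ∀ x lam, ‖x‖ ≤ R → |lam| ≤ R →
      |fderiv ℝ P.h x (P.feedback U γ lam x)| ≤ K := by
  have hfield : Continuous fun p : EuclideanSpace ℝ (Fin n) × ℝ => P.feedback U γ p.2 p.1 := by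
    have hh := P.h_smooth.continuous
    exact P.g_smooth.continuous.comp (continuous_fst.prodMk (by fun_prop : Continuous fun
      p : EuclideanSpace ℝ (Fin n) × ℝ => -γ * P.h p.1 + p.2 + U (P.h p.1)))
  have hcont : Continuous fun p : EuclideanSpace ℝ (Fin n) × ℝ =>
      fderiv ℝ P.h p.1 (P.feedback U γ p.2 p.1) :=
    ((P.h_smooth.continuous_fderiv (by simp)).comp continuous_fst).clm_apply hfield
  obtain ⟨K, hK⟩ := (isCompact_closedBall (0 : EuclideanSpace ℝ (Fin n) × ℝ)
    R).exists_bound_of_continuousOn hcont.continuousOn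
  refine ⟨K, fun x lam hx hlam => hK (x, lam) ?_⟩
  simpa [Prod.norm_def] using ⟨hx, hlam⟩

end Agent

end Passivity

section ClosedLoop

variable {N : ℕ} {G : WeightedGraph N} {n k : Fin N → ℕ} {P : ∀ i, Agent (n i)}
  {U : Fin N → ℝ → ℝ} {freq : ∀ i, Fin (k i) → ℝ} {L : ∀ i, ObsIndex (k i) → ℝ} {γ : ℝ}
  {d : Fin N → ℝ → ℝ}

theorem contDiff_loopField {r : WithTop ℕ∞} (hr : r ≤ ∞) (hU : ∀ i, ContDiff ℝ r (U i))
    (hd : ∀ i, ContDiff ℝ r (d i)) :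
    ContDiff ℝ r (Function.uncurry (loopField G P U freq L γ d)) := by
  have hx (i : Fin N) : ContDiff ℝ r fun q : ℝ × LoopState n k => q.2.1 i :=
    contDiff_pi.1 (by fun_prop) i
  have hη (i : Fin N) : ContDiff ℝ r fun q : ℝ × LoopState n k => q.2.2.2.1 i :=
    contDiff_pi.1 (by fun_prop) i
  have hy (i : Fin N) : ContDiff ℝ r fun q : ℝ × LoopState n k => (P i).h (q.2.1 i) :=
    ((P i).h_smooth.of_le hr).comp (hx i)
  have hu (i : Fin N) : ContDiff ℝ r fun q : ℝ × LoopState n k => U i ((P i).h (q.2.1 i)) :=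
    (hU i).comp (hy i)
  have hlam (i : Fin N) : ContDiff ℝ r fun q : ℝ × LoopState n k => G.disagreement q.2.2.1 i :=
    contDiff_pi.1 (G.contDiff_disagreement.comp (by fun_prop)) i
  have hz (i : Fin N) : ContDiff ℝ r fun q : ℝ × LoopState n k => G.disagreement q.2.2.2.2 i :=
    contDiff_pi.1 (G.contDiff_disagreement.comp (by fun_prop)) i
  have hd' (i : Fin N) : ContDiff ℝ r fun q : ℝ × LoopState n k => d i q.1 :=
    (hd i).comp contDiff_fst
  refine ContDiff.prodMk (contDiff_pi.2 fun i => ?_) (ContDiff.prodMk (contDiff_pi.2 fun i => ?_)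
    (ContDiff.prodMk (contDiff_pi.2 fun i => ?_) (contDiff_pi.2 hlam)))
  · exact ((P i).g_smooth.of_le hr).comp
      ((hx i).prodMk (((contDiff_const.mul (hy i)).add (by fun_prop)).add (hu i)))
  · exact ((((hlam i).neg.sub (hz i)).add (hd' i)).sub (hy i)).sub
      (ContDiff.sum fun p _ => contDiff_const.mul (contDiff_pi.1 (hη i) p))
  · exact ((observerMatrix (freq i) (L i)).mulVecLin.toContinuousLinearMap.contDiff.comp
      (hη i)).add ((hd' i).smul contDiff_const)

theorem SolvesOn.agent {I : Set ℝ} {w : ℝ → LoopState n k}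
    (hw : SolvesOn (loopField G P U freq L γ d) I w) (i : Fin N) :
    SolvesOn (fun t => (P i).feedback (U i) γ ((w t).2.1 i)) I fun t => (w t).1 i := fun t ht =>
  hasDerivWithinAt_pi.1 (hasFDerivAt_fst.comp_hasDerivWithinAt t (hw t ht)) i

theorem SolvesOn.observer {I : Set ℝ} {w : ℝ → LoopState n k}
    (hw : SolvesOn (loopField G P U freq L γ d) I w) (i : Fin N) :
    SolvesOn (fun t η => observerMatrix (freq i) (L i) *ᵥ η + d i t • L i) I
      fun t => (w t).2.2.1 i := fun t ht =>
  hasDerivWithinAt_pi.1 (hasFDerivAt_fst.comp_hasDerivWithinAt t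
    (hasFDerivAt_snd.comp_hasDerivWithinAt t
      (hasFDerivAt_snd.comp_hasDerivWithinAt t (hw t ht)))) i

variable {V : ∀ i, EuclideanSpace ℝ (Fin (n i)) → ℝ} {lam₀ m : ℝ} {zs d₀ M : Fin N → ℝ}

/-- The total storage of the closed loop relative to the steady state `(lam₀, zs)` of the
multipliers and integrators. The constants `1` are added so that the storage dominates
`|lam i - lam₀|` and `|z i - zs i|`, and not only their squares. -/
noncomputable def loopStorage (V : ∀ i, EuclideanSpace ℝ (Fin (n i)) → ℝ) (lam₀ : ℝ)
    (zs : Fin N → ℝ) (w : LoopState n k) : ℝ :=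
  ∑ i, (V i (w.1 i) + ((w.2.1 i - lam₀) ^ 2 + 1) / 2 + ((w.2.2.2 i - zs i) ^ 2 + 1) / 2)

/-- The derivative of the total storage at the state `w` in the direction `v`. -/
noncomputable def loopStorageDeriv (V : ∀ i, EuclideanSpace ℝ (Fin (n i)) → ℝ) (lam₀ : ℝ)
    (zs : Fin N → ℝ) (w v : LoopState n k) : ℝ :=
  ∑ i, (fderiv ℝ (V i) (w.1 i) (v.1 i) + (w.2.1 i - lam₀) * v.2.1 i
    + (w.2.2.2 i - zs i) * v.2.2.2 i)

theorem hasDerivWithinAt_loopStorage (hV : ∀ i, Differentiable ℝ (V i)) {w : ℝ → LoopState n k}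
    {v : LoopState n k} {I : Set ℝ} {t : ℝ} (hw : HasDerivWithinAt w v I t) :
    HasDerivWithinAt (fun s => loopStorage V lam₀ zs (w s)) (loopStorageDeriv V lam₀ zs (w t) v)
      I t := by
  have hsnd := hasFDerivAt_snd.comp_hasDerivWithinAt t hw
  have hx := hasDerivWithinAt_pi.1 (hasFDerivAt_fst.comp_hasDerivWithinAt t hw)
  have hlam := hasDerivWithinAt_pi.1 (hasFDerivAt_fst.comp_hasDerivWithinAt t hsnd)
  have hz := hasDerivWithinAt_pi.1 (hasFDerivAt_snd.comp_hasDerivWithinAt t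
    (hasFDerivAt_snd.comp_hasDerivWithinAt t hsnd))
  have hsq {f : ℝ → ℝ} {f' : ℝ} (a : ℝ) (hf : HasDerivWithinAt f f' I t) :
      HasDerivWithinAt (fun s => (f s - a) ^ 2) (2 * ((f t - a) * f')) I t :=
    ((hf.sub_const a).pow 2).congr_deriv (by ring)
  refine HasDerivWithinAt.fun_sum fun i _ => ?_
  refine ((((hV i _).hasFDerivAt.comp_hasDerivWithinAt t (hx i)).add
    (((hsq lam₀ (hlam i)).add_const 1).div_const 2)).add
      (((hsq (zs i) (hz i)).add_const 1).div_const 2)).congr_deriv ?_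
  rw [mul_div_cancel_left₀ _ two_ne_zero, mul_div_cancel_left₀ _ two_ne_zero]
  rfl

theorem loopStorage_nonneg (hV : ∀ i x, 0 ≤ V i x) (w : LoopState n k) :
    0 ≤ loopStorage V lam₀ zs w :=
  Finset.sum_nonneg fun i _ => by
    have := hV i (w.1 i)
    positivity

theorem sum_storage_add_abs_le_loopStorage (w : LoopState n k) :
    ∑ i, (V i (w.1 i) + |w.2.1 i - lam₀| + |w.2.2.2 i - zs i|) ≤ loopStorage V lam₀ zs w := by
  have hamgm (a : ℝ) : |a| ≤ (a ^ 2 + 1) / 2 := by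
    rw [← sq_abs]
    linarith [sq_nonneg (|a| - 1)]
  exact Finset.sum_le_sum fun i _ => add_le_add (add_le_add_right (hamgm _) _) (hamgm _)

theorem sum_abs_le_loopStorage (hV : ∀ i x, 0 ≤ V i x) (w : LoopState n k) :
    ∑ i, |w.2.1 i - lam₀| ≤ loopStorage V lam₀ zs w :=
  le_trans (Finset.sum_le_sum fun i _ => by
    linarith [hV i (w.1 i), abs_nonneg (w.2.2.2 i - zs i)]) (sum_storage_add_abs_le_loopStorage w)

theorem exists_norm_le_of_loopStorage_le (hV : ∀ i x, 0 ≤ V i x)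
    (hproper : ∀ i W, ∃ R, ∀ x, V i x ≤ W → ‖x‖ ≤ R) (W : ℝ) :
    ∃ R, 0 ≤ R ∧ ∀ w : LoopState n k, loopStorage V lam₀ zs w ≤ W →
      ‖w.1‖ ≤ R ∧ ‖w.2.1‖ ≤ R ∧ ‖w.2.2.2‖ ≤ R := by
  choose r hr using fun i => hproper i W
  set R := ‖r‖ + |lam₀| + ‖zs‖ + |W|
  have hR0 : 0 ≤ R := by positivity
  refine ⟨R, hR0, fun w hw => ?_⟩
  have hterm (i : Fin N) : V i (w.1 i) + |w.2.1 i - lam₀| + |w.2.2.2 i - zs i| ≤ W :=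
    (Finset.single_le_sum (f := fun i => V i (w.1 i) + |w.2.1 i - lam₀| + |w.2.2.2 i - zs i|)
      (fun j _ => by have := hV j (w.1 j); positivity) (Finset.mem_univ i)).trans
      ((sum_storage_add_abs_le_loopStorage w).trans hw)
  have hWabs := le_abs_self W
  refine ⟨(pi_norm_le_iff_of_nonneg hR0).2 fun i => ?_,
    (pi_norm_le_iff_of_nonneg hR0).2 fun i => ?_, (pi_norm_le_iff_of_nonneg hR0).2 fun i => ?_⟩
  · have hxr : ‖w.1 i‖ ≤ r i :=
      hr i _ (by linarith [hterm i, abs_nonneg (w.2.1 i - lam₀), abs_nonneg (w.2.2.2 i - zs i)])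
    linarith [(le_abs_self _).trans (norm_le_pi_norm r i), abs_nonneg lam₀, norm_nonneg zs,
      abs_nonneg W]
  · rw [Real.norm_eq_abs]
    linarith [hterm i, hV i (w.1 i), abs_nonneg (w.2.2.2 i - zs i), norm_nonneg r, norm_nonneg zs,
      abs_sub_abs_le_abs_sub (w.2.1 i) lam₀]
  · have hzsi : |zs i| ≤ ‖zs‖ := norm_le_pi_norm zs i
    rw [Real.norm_eq_abs]
    linarith [hterm i, hV i (w.1 i), abs_nonneg (w.2.1 i - lam₀), norm_nonneg r, abs_nonneg lam₀,
      abs_sub_abs_le_abs_sub (w.2.2.2 i) (zs i)]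

theorem loopStorageDeriv_loopField_le {t ε : ℝ} {w : LoopState n k}
    (hV : ∀ i, (P i).IsStorage m (U i m) (V i))
    (hzs : G.disagreement zs = fun i => d₀ i - m)
    (hU : ∀ i, ((P i).h (w.1 i) - m) * (U i ((P i).h (w.1 i)) - U i m) ≤
      M i * ((P i).h (w.1 i) - m) ^ 2)
    (hε0 : 0 ≤ ε) (hε : ∀ i, |d i t - d₀ i - distRow (k i) ⬝ᵥ w.2.2.1 i| ≤ ε) :
    loopStorageDeriv V (γ * m) zs w (loopField G P U freq L γ d t w) ≤
      -∑ i, (γ - M i) * ((P i).h (w.1 i) - m) ^ 2 + ε * loopStorage V (γ * m) zs w := by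
  obtain ⟨x, lam, η, z⟩ := w
  set y := fun i => (P i).h (x i)
  set q := fun i => d i t - distRow (k i) ⬝ᵥ η i
  have hagents : ∑ i, fderiv ℝ (V i) (x i) ((P i).feedback (U i) γ (lam i) (x i)) ≤
      ∑ i, (-((γ - M i) * (y i - m) ^ 2) + (y i - m) * (lam i - γ * m)) :=
    Finset.sum_le_sum fun i _ => (hV i).fderiv_feedback_le (hU i)
  have hnetwork := G.sum_multiplier_supply_le (lam := lam) (z := z) (y := y) (q := q)
    (lam₀ := γ * m) hzs
  have herror : ∑ i, (lam i - γ * m) * (q i - d₀ i) ≤ ε * loopStorage V (γ * m) zs (x, lam, η, z) :=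
    calc ∑ i, (lam i - γ * m) * (q i - d₀ i) ≤ ∑ i, ε * |lam i - γ * m| :=
          Finset.sum_le_sum fun i _ => by
            rw [mul_comm ε]
            refine (le_abs_self _).trans ((abs_mul _ _).trans_le ?_)
            gcongr
            simpa only [q, sub_right_comm] using hε i
      _ = ε * ∑ i, |lam i - γ * m| := (Finset.mul_sum _ _ _).symm
      _ ≤ _ := by
          gcongr
          exact sum_abs_le_loopStorage (fun i => (hV i).nonneg) (x, lam, η, z)
  calc loopStorageDeriv V (γ * m) zs (x, lam, η, z) (loopField G P U freq L γ d t (x, lam, η, z))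
      = ∑ i, fderiv ℝ (V i) (x i) ((P i).feedback (U i) γ (lam i) (x i))
        + ∑ i, ((lam i - γ * m) * (-G.disagreement lam i - G.disagreement z i + q i - y i)
          + (z i - zs i) * G.disagreement lam i) := by
        rw [← Finset.sum_add_distrib]
        refine Finset.sum_congr rfl fun i _ => ?_
        simp only [loopField, Agent.feedback, q, y]
        ring
    _ ≤ ∑ i, (-((γ - M i) * (y i - m) ^ 2) + (y i - m) * (lam i - γ * m))
        + ∑ i, (lam i - γ * m) * (q i - (d₀ i - m) - y i) := add_le_add hagents hnetwork
    _ = -∑ i, (γ - M i) * (y i - m) ^ 2 + ∑ i, (lam i - γ * m) * (q i - d₀ i) := by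
        rw [← Finset.sum_neg_distrib, ← Finset.sum_add_distrib, ← Finset.sum_add_distrib]
        exact Finset.sum_congr rfl fun i _ => by ring
    _ ≤ _ := by gcongr

variable {amp phase : ∀ i, Fin (k i) → ℝ} {b κ T : ℝ} {w : ℝ → LoopState n k}

theorem exists_loop_observer_error_le (hL : ∀ i, IsHurwitz (observerMatrix (freq i) (L i)))
    (w₀ : LoopState n k) :
    ∃ b κ, 0 < b ∧ 0 ≤ κ ∧ ∀ (T : ℝ) (w : ℝ → LoopState n k), w 0 = w₀ →
      SolvesOn (loopField G P U freq L γ fun i => observation (d₀ i) (freq i) (amp i) (phase i))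
        (Icc 0 T) w →
      ∀ t ∈ Icc 0 T, ∀ i,
        ‖(w t).2.2.1 i - exoState (d₀ i) (freq i) (amp i) (phase i) t‖ ≤ κ * Real.exp (-b * t) ∧
        |observation (d₀ i) (freq i) (amp i) (phase i) t - d₀ i - distRow (k i) ⬝ᵥ (w t).2.2.1 i| ≤
          κ * Real.exp (-b * t) := by
  choose b κ hb hκ hdecay using fun i => exists_norm_observer_error_le (d₀ := d₀ i)
    (amp := amp i) (phase := phase i) (hL i) (w₀.2.2.1 i)
  set c : Fin N → ℝ := fun i => ∑ p, |distRow (k i) p|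
  have hc (i : Fin N) : 0 ≤ c i := Finset.sum_nonneg fun _ _ => abs_nonneg _
  obtain ⟨b', κ', hb', hκ', hle⟩ := exists_mul_exp_neg_mul_le hb
    fun i => mul_nonneg (add_nonneg zero_le_one (hc i)) (hκ i)
  refine ⟨b', κ', hb', hκ', ?_⟩
  rintro T w rfl hw t ht i
  have hη := hdecay i T _ rfl (hw.observer i) t ht
  have hpos := (norm_nonneg _).trans hη
  have hle := hle i t ht.1
  refine ⟨?_, (abs_disturbance_error_le _ t).trans ?_⟩
  · linarith [mul_nonneg (hc i) hpos]
  · linarith [mul_le_mul_of_nonneg_left hη (hc i)]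

theorem exists_norm_loopState_le (hV : ∀ i x, 0 ≤ V i x)
    (hproper : ∀ i W, ∃ R, ∀ x, V i x ≤ W → ‖x‖ ≤ R) (W K T : ℝ) :
    ∃ R, ∀ t ∈ Icc 0 T, ∀ w : LoopState n k, loopStorage V lam₀ zs w ≤ W →
      (∀ i, ‖w.2.2.1 i - exoState (d₀ i) (freq i) (amp i) (phase i) t‖ ≤ K) → ‖w‖ ≤ R := by
  obtain ⟨R, hR0, hR⟩ := exists_norm_le_of_loopStorage_le (k := k) (lam₀ := lam₀) (zs := zs)
    hV hproper W
  obtain ⟨B, hB⟩ := isCompact_Icc.exists_bound_of_continuousOn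
    (continuous_pi fun i => continuous_exoState (d₀ := d₀ i) (freq := freq i) (amp := amp i)
      (phase := phase i)).continuousOn (s := Icc 0 T)
  refine ⟨max R (max 0 (B + K)), fun t ht w hW hη => ?_⟩
  obtain ⟨hx, hlam, hz⟩ := hR w hW
  refine norm_prod_le_iff.2 ⟨hx.trans (le_max_left _ _), norm_prod_le_iff.2
    ⟨hlam.trans (le_max_left _ _), norm_prod_le_iff.2 ⟨?_, hz.trans (le_max_left _ _)⟩⟩⟩
  refine (pi_norm_le_iff_of_nonneg (hR0.trans (le_max_left _ _))).2 fun i => ?_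
  calc ‖w.2.2.1 i‖ ≤ ‖exoState (d₀ i) (freq i) (amp i) (phase i) t‖
        + ‖w.2.2.1 i - exoState (d₀ i) (freq i) (amp i) (phase i) t‖ :=
        norm_le_norm_add_norm_sub' _ _
    _ ≤ B + K := add_le_add ((norm_le_pi_norm _ i).trans (hB t ht)) (hη i)
    _ ≤ _ := (le_max_right _ _).trans (le_max_right _ _)

theorem loopStorage_le_of_solvesOn (hV : ∀ i, (P i).IsStorage m (U i m) (V i))
    (hzs : G.disagreement zs = fun i => d₀ i - m) (hγ : ∀ i, M i ≤ γ) (hb : 0 < b) (hκ : 0 ≤ κ)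
    (hw : SolvesOn (loopField G P U freq L γ d) (Icc 0 T) w)
    (hU : ∀ t ∈ Icc 0 T, ∀ i, ((P i).h ((w t).1 i) - m) * (U i ((P i).h ((w t).1 i)) - U i m) ≤
      M i * ((P i).h ((w t).1 i) - m) ^ 2)
    (hd : ∀ t ∈ Icc 0 T, ∀ i, |d i t - d₀ i - distRow (k i) ⬝ᵥ (w t).2.2.1 i| ≤
      κ * Real.exp (-b * t)) :
    ∀ t ∈ Icc 0 T, loopStorage V (γ * m) zs (w t) ≤
      loopStorage V (γ * m) zs (w 0) * Real.exp (κ / b) := by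
  refine fun t ht => le_of_deriv_le_exp_mul hb hκ
    (fun s hs => hasDerivWithinAt_loopStorage (fun i => (hV i).differentiable) (hw s hs))
    (fun s _ => loopStorage_nonneg (fun i => (hV i).nonneg) (w s)) (fun s hs => ?_) ht
  have hle := loopStorageDeriv_loopField_le (γ := γ) (freq := freq) (L := L) hV hzs (hU s hs)
    (by positivity) (hd s hs)
  have hdiss : 0 ≤ ∑ i, (γ - M i) * ((P i).h ((w s).1 i) - m) ^ 2 :=
    Finset.sum_nonneg fun i _ => mul_nonneg (sub_nonneg.2 (hγ i)) (sq_nonneg _)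
  linarith

theorem tendsto_output_of_solvesOn (hV : ∀ i, (P i).IsStorage m (U i m) (V i))
    (hUc : ∀ i, Continuous (U i))
    (hzs : G.disagreement zs = fun i => d₀ i - m) (hγ : ∀ i, M i < γ) (hb : 0 < b) (hκ : 0 ≤ κ)
    (hw : SolvesOn (loopField G P U freq L γ d) (Ici 0) w)
    (hU : ∀ t ∈ Ici 0, ∀ i, ((P i).h ((w t).1 i) - m) * (U i ((P i).h ((w t).1 i)) - U i m) ≤
      M i * ((P i).h ((w t).1 i) - m) ^ 2)
    (hd : ∀ t ∈ Ici 0, ∀ i, |d i t - d₀ i - distRow (k i) ⬝ᵥ (w t).2.2.1 i| ≤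
      κ * Real.exp (-b * t)) {R : ℝ} (hx : ∀ t ∈ Ici 0, ‖(w t).1‖ ≤ R)
    (hlam : ∀ t ∈ Ici 0, ‖(w t).2.1‖ ≤ R) (i : Fin N) :
    Tendsto (fun t => (P i).h ((w t).1 i)) atTop (𝓝 m) := by
  obtain ⟨K, hK⟩ := (P i).exists_abs_fderiv_output_feedback_le (hUc i) γ R
  have hh : Differentiable ℝ (P i).h := (P i).h_smooth.differentiable (by simp)
  have hlim := tendsto_zero_of_deriv_le_neg_sq_add_exp_mul hb (sub_pos.2 (hγ i)) hκ
    (fun t ht => hasDerivWithinAt_loopStorage (lam₀ := γ * m) (zs := zs)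
      (fun j => (hV j).differentiable) (hw t ht))
    (fun t _ => loopStorage_nonneg (fun j => (hV j).nonneg) (w t)) (fun t ht => ?_)
    (fun t ht => ((hh _).hasFDerivAt.comp_hasDerivWithinAt t (hw.agent i t ht)).sub_const m)
    fun t ht => hK _ _ ((norm_le_pi_norm _ i).trans (hx t ht))
      ((norm_le_pi_norm _ i).trans (hlam t ht))
  · simpa only [Function.comp_apply, sub_add_cancel, zero_add] using hlim.add_const m
  · refine (loopStorageDeriv_loopField_le hV hzs (hU t ht) (by positivity) (hd t ht)).trans ?_
    gcongr
    exact Finset.single_le_sum (f := fun j => (γ - M j) * ((P j).h ((w t).1 j) - m) ^ 2)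
      (fun j _ => mul_nonneg (sub_nonneg.2 (hγ j).le) (sq_nonneg _)) (Finset.mem_univ i)

end ClosedLoop

theorem mul_sub_le_of_lipschitzOnWith {f : ℝ → ℝ} {K : ℝ≥0} {s : Set ℝ}
    (hf : LipschitzOnWith K f s) {x y : ℝ} (hx : x ∈ s) (hy : y ∈ s) :
    (x - y) * (f x - f y) ≤ K * (x - y) ^ 2 :=
  calc (x - y) * (f x - f y) ≤ |x - y| * |f x - f y| := (le_abs_self _).trans (abs_mul _ _).le
    _ ≤ |x - y| * (K * |x - y|) := by
        gcongr
        exact hf.dist_le_mul x hx y hy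
    _ = K * (x - y) ^ 2 := by
        rw [← sq_abs]
        ring

theorem corollary2_general {N : ℕ} (G : WeightedGraph N) (hG : G.toSimpleGraph.Connected)
    {n : Fin N → ℕ} {P : ∀ i, Agent (n i)} {d₀ ys : Fin N → ℝ}
    (hys : IsOptimalAllocation (fun _ s => s ^ 2 / 2) d₀ ys)
    {U : Fin N → ℝ → ℝ} (hU : ∀ i, ContDiff ℝ 1 (U i))
    {xs : ∀ i, EuclideanSpace ℝ (Fin (n i))} (hxs : ∀ i, (P i).h (xs i) = ys i)
    (hpass : ∀ i, (P i).PassiveAt (xs i) (U i (ys i)))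
    {k : Fin N → ℕ} {freq amp phase : ∀ i, Fin (k i) → ℝ}
    {L : ∀ i, ObsIndex (k i) → ℝ} (hL : ∀ i, IsHurwitz (observerMatrix (freq i) (L i)))
    {M : Fin N → ℝ} {γ : ℝ} (hγ : ∀ i, M i < γ) {w₀ : LoopState n k}
    (hM : ∀ (T : ℝ) (w : ℝ → LoopState n k), w 0 = w₀ →
      SolvesOn (loopField G P U freq L γ fun i => observation (d₀ i) (freq i) (amp i) (phase i))
        (Icc 0 T) w →
      ∀ t ∈ Icc 0 T, ∀ i, ((P i).h ((w t).1 i) - ys i) *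
        (U i ((P i).h ((w t).1 i)) - U i (ys i)) ≤ M i * ((P i).h ((w t).1 i) - ys i) ^ 2) :
    (∃ w : ℝ → LoopState n k, w 0 = w₀ ∧
      SolvesOn (loopField G P U freq L γ fun i => observation (d₀ i) (freq i) (amp i) (phase i))
        (Ici 0) w) ∧
    ∀ w : ℝ → LoopState n k, w 0 = w₀ →
      SolvesOn (loopField G P U freq L γ fun i => observation (d₀ i) (freq i) (amp i) (phase i))
        (Ici 0) w →
      (∀ i, ∃ B : ℝ, ∀ t, 0 ≤ t → ‖(w t).1 i‖ ≤ B) ∧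
      ∀ i, Tendsto (fun t => (P i).h ((w t).1 i)) atTop (𝓝 ((1 / (N : ℝ)) * ∑ j, d₀ j)) := by
  set m := (1 / (N : ℝ)) * ∑ j, d₀ j
  set F := loopField G P U freq L γ fun i => observation (d₀ i) (freq i) (amp i) (phase i)
  obtain rfl : ys = fun _ => m := funext hys.eq_average
  choose V hV using fun i => (hxs i ▸ (hpass i).exists_isStorage : ∃ V, (P i).IsStorage m _ V)
  have hV0 (i : Fin N) := (hV i).nonneg
  have hproper (i : Fin N) := (hV i).exists_norm_le
  obtain ⟨zs, hzs⟩ : ∃ zs, G.disagreement zs = fun i => d₀ i - m :=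
    G.exists_disagreement_eq hG (by rw [Finset.sum_sub_distrib, hys.1, sub_self])
  obtain ⟨b, κ, hb, hκ, herror⟩ := exists_loop_observer_error_le (G := G) (P := P) (U := U)
    (γ := γ) (d₀ := d₀) (amp := amp) (phase := phase) hL w₀
  set W := loopStorage V (γ * m) zs w₀ * Real.exp (κ / b)
  have hstorage {T : ℝ} {w : ℝ → LoopState n k} (h0 : w 0 = w₀) (hw : SolvesOn F (Icc 0 T) w) :
      ∀ t ∈ Icc 0 T, loopStorage V (γ * m) zs (w t) ≤ W := by
    subst h0
    exact loopStorage_le_of_solvesOn hV hzs (fun i => (hγ i).le) hb hκ hw (hM T w rfl hw)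
      fun t ht i => (herror T w rfl hw t ht i).2
  refine ⟨exists_solvesOn_Ici (contDiff_loopField (by simp) hU fun _ => contDiff_observation)
    fun T => ?_, fun w h0 hw => ?_⟩
  · obtain ⟨R, hR⟩ := exists_norm_loopState_le (lam₀ := γ * m) (zs := zs) (d₀ := d₀) (freq := freq)
      (amp := amp) (phase := phase) hV0 hproper W κ T
    refine ⟨R, fun τ hτ w h0 hw => hR τ hτ (w τ) (hstorage h0 hw τ ⟨hτ.1, le_rfl⟩) fun i =>
      (herror τ w h0 hw τ ⟨hτ.1, le_rfl⟩ i).1.trans (mul_le_of_le_one_right hκ ?_)⟩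
    exact Real.exp_le_one_iff.2 (by nlinarith [hτ.1])
  · have hwT (t : ℝ) := hw.mono (Icc_subset_Ici_self : Icc 0 t ⊆ Ici 0)
    obtain ⟨R, -, hR⟩ := exists_norm_le_of_loopStorage_le (k := k) (lam₀ := γ * m) (zs := zs)
      hV0 hproper W
    have hbound (t : ℝ) (ht : 0 ≤ t) := hR (w t) (hstorage h0 (hwT t) t ⟨ht, le_rfl⟩)
    refine ⟨fun i => ⟨R, fun t ht => (norm_le_pi_norm _ i).trans (hbound t ht).1⟩, ?_⟩
    exact tendsto_output_of_solvesOn hV (fun i => (hU i).continuous) hzs hγ hb hκ hw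
      (fun t ht => hM t w h0 (hwT t) t ⟨ht, le_rfl⟩)
      (fun t ht i => (herror t w h0 (hwT t) t ⟨ht, le_rfl⟩ i).2)
      (fun t ht => (hbound t ht).1) fun t ht => (hbound t ht).2.1

theorem corollary2 {N : ℕ}
    -- the communication graph
    (G : WeightedGraph N) (hG : G.toSimpleGraph.Connected)
    -- the agents and their private data
    (n : Fin N → ℕ) (P : ∀ i, Agent (n i)) (d₀ : Fin N → ℝ)
    -- the optimal solution of the allocation problem with costs `s ^ 2 / 2`
    (ys : Fin N → ℝ) (hys : IsOptimalAllocation (fun _ s => s ^ 2 / 2) d₀ ys)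
    -- the regulator equations; `C i` is the set of outputs on which `U i` is Lipschitz
    (X : ∀ i, ℝ → EuclideanSpace ℝ (Fin (n i))) (U : Fin N → ℝ → ℝ)
    (hreg : ∀ i, (P i).IsRegulator (X i) (U i))
    (C : Fin N → Set ℝ) (hC : ∀ i, ys i ∈ C i)
    (M : Fin N → ℝ≥0) (hM : ∀ i, LipschitzOnWith (M i) (U i) (C i))
    -- passivity at the optimal steady state
    (hpass : ∀ i, (P i).PassiveAt (X i (ys i)) (U i (ys i)))
    -- the sinusoidal disturbances
    (k : Fin N → ℕ) (freq amp phase : ∀ i, Fin (k i) → ℝ)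
    (h_freq : ∀ i j, 0 < freq i j) (h_freq_inj : ∀ i, Function.Injective (freq i))
    -- the gains
    (L : ∀ i, ObsIndex (k i) → ℝ) (hL : ∀ i, IsHurwitz (observerMatrix (freq i) (L i)))
    (γ : ℝ) (hγ : ∀ i, 1 + (M i : ℝ) < γ)
    -- an initial state whose closed-loop solutions, as long as they exist, have their outputs
    -- in the sets `C i` (no restriction if `C i = univ`)
    (w₀ : LoopState n k)
    (hw₀ : ∀ (T : ℝ) (w : ℝ → LoopState n k), w 0 = w₀ →
      SolvesOn (loopField G P U freq L γ fun i => observation (d₀ i) (freq i) (amp i) (phase i))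
        (Icc 0 T) w →
      ∀ t ∈ Icc 0 T, ∀ i, (P i).h ((w t).1 i) ∈ C i) :
    -- the closed loop has a solution for all future time, and every such solution has bounded
    -- agent trajectories and outputs that converge to the average
    (∃ w : ℝ → LoopState n k, w 0 = w₀ ∧
      SolvesOn (loopField G P U freq L γ fun i => observation (d₀ i) (freq i) (amp i) (phase i))
        (Ici 0) w) ∧
    ∀ w : ℝ → LoopState n k, w 0 = w₀ →
      SolvesOn (loopField G P U freq L γ fun i => observation (d₀ i) (freq i) (amp i) (phase i))
        (Ici 0) w →
      (∀ i, ∃ B : ℝ, ∀ t, 0 ≤ t → ‖(w t).1 i‖ ≤ B) ∧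
      (∀ i, Tendsto (fun t => (P i).h ((w t).1 i)) atTop (𝓝 ((1 / (N : ℝ)) * ∑ j, d₀ j))) ∧
      -- in particular, output average consensus
      ((∀ j, d₀ j = (P j).h (w₀.1 j)) →
        ∀ i, Tendsto (fun t => (P i).h ((w t).1 i)) atTop
          (𝓝 ((1 / (N : ℝ)) * ∑ j, (P j).h (w₀.1 j)))) := by
  obtain ⟨hsolve, hconv⟩ := corollary2_general G hG hys (fun i => (hreg i).1.smooth_input.of_le
    (by simp)) (fun i => (hreg i).1.output (ys i)) hpass hL (M := fun i => M i)
    (fun i => (lt_one_add _).trans (hγ i)) fun T w h0 hw t ht i =>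
      mul_sub_le_of_lipschitzOnWith (hM i) (hw₀ T w h0 hw t ht i) (hC i)
  refine ⟨hsolve, fun w h0 hw => ⟨(hconv w h0 hw).1, (hconv w h0 hw).2, fun hd₀ => ?_⟩⟩
  simpa only [hd₀] using (hconv w h0 hw).2
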